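/- Let $H$ be a complex Hilbert space of finite dimension $N$, with inner product $\langle\cdot,\cdot\rangle$ linear in the first variable, and let $A,B$ be linear operators on $H$. Put $A_\gamma=A+\gamma B$ and $p(\gamma,\lambda)=\det(A+\gamma B-\lambda I)$ for $\gamma,\lambda\in\mathbb C$, let $\mathbb C_+=\{z:\operatorname{Im}z>0\}$, and let $\arg$ take values in $(-\pi,\pi]$. Assume: (H1) $A=A^*$, and $B$ is sectorial: there are constants $\sigma_1,\sigma_2\in[0,\pi/2)$ such that for every $f\in H$ either $\langle Bf,f\rangle=0$ or $-\sigma_1\le\arg\langle Bf,f\rangle\le\sigma_2$. Let $M=\operatorname{rank}B$. (H2) $B$ is cyclic for $A$: the vectors $A^nBv$ ($n\ge 0$, $v\in H$) span $H$. (H3) Every eigenvalue of $A$ has algebraic multiplicity $1$. (H4) Every non-zero eigenvalue of $B$ has algebraic multiplicity $1$. (H5) Every eigenvalue of the truncation $A^\natural=PAP|_{\operatorname{Ker}B}$ has algebraic multiplicity $1$, where $P$ is the orthogonal projection onto $\operatorname{Ker}B$. Let $S_B=\{0\}\cup\{\gamma\ne0:\sigma_1<\arg\gamma<\pi-\sigma_2\}$,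 and let $F$ be the set of all $\gamma\in S_B$ such that either $A_\gamma$ has an eigenvalue of algebraic multiplicity greater than $1$, or there is $\lambda\in\mathbb C_+$ with $p(\gamma,\lambda)=0$ and $\frac{\partial p}{\partial\gamma}(\gamma,\lambda)=0$. Call a $C^1$ function $c:[0,\infty)\to\mathbb C$ whose derivative (one-sided at $0$) vanishes nowhere on $[0,\infty)$ a regular curve. Let $g$ be a regular curve with $g(0)=0$, $g(t)\in S_B\setminus F$ for all $t>0$, and $|g(t)|\to\infty$ as $t\to\infty$. Let $\alpha_1<\dots<\alpha_N$ be the eigenvalues of $A$ and $\delta_1<\dots<\delta_{N-M}$ the eigenvalues of $A^\natural$. Then there exist $N$ regular curves $\lambda_1,\dots,\lambda_N$ such that $\operatorname{Spec}(A_{g(t)})=\{\lambda_1(t),\dots,\lambda_N(t)\}$ for all $t\ge0$, $\lambda_r(0)=\alpha_r$ for all $r$, and $\lambda_r(t)\in\mathbb C_+$ for all $r$ and all $t\geq0$ with $g(t)\ne0$. Moreover, if $\beta_1,\dots,\beta_M$ are the non-zero eigenvalues of $B$ written in any order, then there is a permutation $\pi$ of $\{1,\dots,N\}$ (depending on $g$)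 such that $$\lim_{t\to\infty}\frac{\lambda_{\pi(r)}(t)}{g(t)}=\beta_r\quad(1\le r\le M),\qquad \lim_{t\to\infty}\lambda_{\pi(M+r)}(t)=\delta_r\quad(1\le r\le N-M).$$ If $g$ is real analytic on $[0,\infty)$, then so are all the curves $\lambda_r$. -/

import Mathlib

open Set Filter Topology

namespace SectorialPerturbation

variable {H : Type*} [NormedAddCommGroup H] [InnerProductSpace ℂ H]

/-- `D` is sectorial with sectorial constants `σ₁`, `σ₂`. Mathlib's inner product is linear in the
second variable, so the number usually written `⟨D f, f⟩` is `inner ℂ f (D f)`. -/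
structure IsSectorial (D : H →ₗ[ℂ] H) (σ₁ σ₂ : ℝ) : Prop where
  nonneg₁ : 0 ≤ σ₁
  lt₁ : σ₁ < Real.pi / 2
  nonneg₂ : 0 ≤ σ₂
  lt₂ : σ₂ < Real.pi / 2
  numericalRange : ∀ f : H, inner ℂ f (D f) = 0 ∨
    (-σ₁ ≤ (inner ℂ f (D f)).arg ∧ (inner ℂ f (D f)).arg ≤ σ₂)

/-- The set `S_B` of admissible coupling constants for sectorial constants `σ₁`, `σ₂`. -/
def couplingSector (σ₁ σ₂ : ℝ) : Set ℂ :=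
  {0} ∪ {γ : ℂ | γ ≠ 0 ∧ σ₁ < γ.arg ∧ γ.arg < Real.pi - σ₂}

/-- `B` is cyclic for `A`: the vectors `A ^ n (B v)` span the (finite-dimensional) space. -/
def IsCyclicFor (B A : H →ₗ[ℂ] H) : Prop :=
  Submodule.span ℂ {w : H | ∃ (n : ℕ) (v : H), w = (A ^ n) (B v)} = ⊤

/-- The truncation `P A P |_K` of `A` to `K`, with `P` the orthogonal projection onto `K`. -/
noncomputable def truncation (A : H →ₗ[ℂ] H) (K : Submodule ℂ H) [K.HasOrthogonalProjection] :
    K →ₗ[ℂ] K :=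
  (K.orthogonalProjectionOnto : H →ₗ[ℂ] K) ∘ₗ A ∘ₗ K.subtype

/-- The eigenvalue `μ` of `T` has algebraic multiplicity one: it is a simple root of the
characteristic polynomial. -/
def IsSimpleEigenvalue {E : Type*} [AddCommGroup E] [Module ℂ E] [FiniteDimensional ℂ E]
    (T : E →ₗ[ℂ] E) (μ : ℂ) : Prop :=
  T.charpoly.rootMultiplicity μ = 1

/-- The function `p (γ, z) = det (A + γ B - z I)`. -/
noncomputable def detFun (A B : H →ₗ[ℂ] H) (γ z : ℂ) : ℂ :=
  LinearMap.det (A + γ • B - z • (1 : H →ₗ[ℂ] H))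

/-- The exceptional coupling constants in `S_B`: those `γ` for which `A + γ B` has a multiple
eigenvalue, and those for which `p (γ, z) = 0` and `∂p/∂γ (γ, z) = 0` for some `z` in the open
upper half-plane. -/
def exceptionalSet [FiniteDimensional ℂ H] (A B : H →ₗ[ℂ] H) (σ₁ σ₂ : ℝ) : Set ℂ :=
  {γ ∈ couplingSector σ₁ σ₂ | ∃ z ∈ spectrum ℂ (A + γ • B), ¬ IsSimpleEigenvalue (A + γ • B) z} ∪
  {γ ∈ couplingSector σ₁ σ₂ | ∃ z : ℂ, 0 < z.im ∧ detFun A B γ z = 0 ∧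
    deriv (fun w : ℂ => detFun A B w z) γ = 0}

/-- A continuously differentiable curve `[0, ∞) → ℂ` whose derivative (one-sided at `0`) never
vanishes. Only the values on `[0, ∞)` matter. -/
structure IsRegularCurve (c : ℝ → ℂ) : Prop where
  contDiffOn : ContDiffOn ℝ 1 c (Ici 0)
  deriv_ne_zero : ∀ t ∈ Ici (0 : ℝ), derivWithin c (Ici 0) t ≠ 0

/-- The class of coupling curves: regular curves in `S_B` from `0` to `∞` that avoid the
exceptional set. -/
structure IsCouplingCurve [FiniteDimensional ℂ H] (A B : H →ₗ[ℂ] H) (σ₁ σ₂ : ℝ) (g : ℝ → ℂ) :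
    Prop where
  regular : IsRegularCurve g
  map_zero : g 0 = 0
  mem : ∀ t : ℝ, 0 < t → g t ∈ couplingSector σ₁ σ₂ \ exceptionalSet A B σ₁ σ₂
  tendsto : Tendsto (fun t => ‖g t‖) atTop atTop

end SectorialPerturbation

open SectorialPerturbation

namespace SectorialPerturbation

open scoped ContDiff

/-! ### The determinant `detFun` and simple eigenvalues. -/

section Determinant

variable {H : Type*} [NormedAddCommGroup H] [InnerProductSpace ℂ H] [FiniteDimensional ℂ H]

/-! The eigenvalues of `A + γ B` are the zeros in `z` of the entire function `p (γ, z)`. Along `g`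
they are simple, so by `exists_implicit` each is locally a holomorphic function `φ` of `γ`. The
graph of the spectrum over the line is therefore a finite covering, and lifting through it glues the
local branches into global curves (`exists_continuous_listing`).

Each curve is locally `φ ∘ g`, so it inherits the smoothness of `g`, and it is regular because `φ' ≠
0`, which amounts to `∂p/∂γ ≠ 0`. Away from `γ = 0` this is what avoiding the exceptional set
provides, since all eigenvalues lie in the upper half-plane (`im_pos_of_mem_spectrum`). At `γ = 0`
it is `deriv_detFun_zero_ne_zero`. Both facts rest on sectoriality: `⟨Bf, f⟩ = 0` forces `Bf = B*f =
0`, and cyclicity then keeps `f` from being an eigenvector of `A`.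

For `γ → ∞` put `s = 1/γ`. Perturbing `B` to `B + sA` yields the eigenvalues asymptotic to `β / s`;
rescaling the complement of `ker B` by `s` yields those tending to `δ`. Together these exhaust the
spectrum, and by connectedness they match the global curves up to one fixed permutation
(`exists_perm_of_range_eq`). -/

theorem contDiff_det {E : Type*} [NormedAddCommGroup E] [NormedSpace ℂ E] {n : ℕ∞ω}
    (T : E → H →ₗ[ℂ] H) (hT : ∀ v, ContDiff ℂ n fun x => T x v) :
    ContDiff ℂ n fun x => LinearMap.det (T x) := by
  have b := Module.finBasis ℂ H
  have h : ∀ x, LinearMap.det (T x) = (LinearMap.toMatrix b b (T x)).det := fun x =>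
    (LinearMap.det_toMatrix b (T x)).symm
  simp only [h, Matrix.det_apply]
  refine ContDiff.sum fun σ _ => ContDiff.const_smul _ (contDiff_prod fun i _ => ?_)
  simp only [LinearMap.toMatrix_apply]
  exact (LinearMap.toContinuousLinearMap (b.coord (σ i))).contDiff.comp (hT (b i))

theorem contDiff_detFun (A B : H →ₗ[ℂ] H) :
    ContDiff ℂ ω fun p : ℂ × ℂ => detFun A B p.1 p.2 := by
  refine contDiff_det _ fun v => ?_
  simp only [LinearMap.sub_apply, LinearMap.add_apply, LinearMap.smul_apply, Module.End.one_apply]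
  fun_prop

theorem det_sub_smul_one {E : Type*} [AddCommGroup E] [Module ℂ E] [FiniteDimensional ℂ E]
    (T : E →ₗ[ℂ] E) (z : ℂ) :
    LinearMap.det (T - z • (1 : E →ₗ[ℂ] E)) =
      (-1) ^ Module.finrank ℂ E * T.charpoly.eval z := by
  rw [LinearMap.eval_charpoly, ← LinearMap.det_smul]
  congr 1
  ext x
  simp [Module.algebraMap_end_apply]

theorem mem_spectrum_iff_det {E : Type*} [AddCommGroup E] [Module ℂ E] [FiniteDimensional ℂ E]
    (T : E →ₗ[ℂ] E) (z : ℂ) :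
    z ∈ spectrum ℂ T ↔ LinearMap.det (T - z • (1 : E →ₗ[ℂ] E)) = 0 := by
  rw [det_sub_smul_one, Module.End.mem_spectrum_iff_isRoot_charpoly, Polynomial.IsRoot.def]
  simp

theorem mem_spectrum_iff_detFun (A B : H →ₗ[ℂ] H) (γ z : ℂ) :
    z ∈ spectrum ℂ (A + γ • B) ↔ detFun A B γ z = 0 :=
  mem_spectrum_iff_det _ _

/-- Up to sign the determinant is the characteristic polynomial, and a simple root is not a root of
the derivative. -/
theorem deriv_det_sub_ne_zero {E : Type*} [AddCommGroup E] [Module ℂ E] [FiniteDimensional ℂ E]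
    {T : E →ₗ[ℂ] E} {z : ℂ} (h : IsSimpleEigenvalue T z) :
    deriv (fun w => LinearMap.det (T - w • (1 : E →ₗ[ℂ] E))) z ≠ 0 := by
  have h0 : T.charpoly ≠ 0 := T.charpoly_monic.ne_zero
  have h1 : ¬ 1 < T.charpoly.rootMultiplicity z := by
    rw [show T.charpoly.rootMultiplicity z = 1 from h]; simp
  have hr : T.charpoly.IsRoot z := by
    rw [← Polynomial.rootMultiplicity_pos h0, show T.charpoly.rootMultiplicity z = 1 from h]
    simp
  rw [Polynomial.one_lt_rootMultiplicity_iff_isRoot h0] at h1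
  simp only [det_sub_smul_one, deriv_const_mul_field', Polynomial.deriv]
  refine mul_ne_zero (by simp) fun h2 => h1 ⟨hr, h2⟩

theorem deriv_detFun_ne_zero {A B : H →ₗ[ℂ] H} {γ z : ℂ} (h : IsSimpleEigenvalue (A + γ • B) z) :
    deriv (fun w => detFun A B γ w) z ≠ 0 :=
  deriv_det_sub_ne_zero h

theorem spectrum_eq_coe_toFinset_roots {E : Type*} [AddCommGroup E] [Module ℂ E]
    [FiniteDimensional ℂ E] (T : E →ₗ[ℂ] E) :
    spectrum ℂ T = (T.charpoly.roots.toFinset : Set ℂ) := by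
  ext z
  rw [Module.End.mem_spectrum_iff_isRoot_charpoly]
  simp [T.charpoly_monic.ne_zero]

theorem ncard_spectrum {E : Type*} [AddCommGroup E] [Module ℂ E] [FiniteDimensional ℂ E]
    {T : E →ₗ[ℂ] E} (h : ∀ z ∈ spectrum ℂ T, IsSimpleEigenvalue T z) :
    (spectrum ℂ T).ncard = Module.finrank ℂ E := by
  have hn : T.charpoly.roots.Nodup := by
    rw [Multiset.nodup_iff_count_le_one]
    intro z
    rw [Polynomial.count_roots]
    by_cases hz : z ∈ spectrum ℂ T
    · exact (h z hz).le
    · rw [Module.End.mem_spectrum_iff_isRoot_charpoly] at hz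
      rw [Polynomial.rootMultiplicity_eq_zero hz]
      simp
  rw [spectrum_eq_coe_toFinset_roots, ncard_coe_finset, Multiset.toFinset_card_of_nodup hn,
    IsAlgClosed.card_roots_eq_natDegree, LinearMap.charpoly_natDegree]

end Determinant

/-- The holomorphic implicit function theorem for a scalar equation `F (x, y) = 0`. -/
theorem exists_implicit {F : ℂ × ℂ → ℂ} (hF : ContDiff ℂ ω F) {a b : ℂ} (h0 : F (a, b) = 0)
    (h2 : deriv (fun z => F (a, z)) b ≠ 0) :
    ∃ φ : ℂ → ℂ, AnalyticAt ℂ φ a ∧ φ a = b ∧ (∀ᶠ v in 𝓝 (a, b), F v = 0 ↔ φ v.1 = v.2) ∧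
      (deriv (fun w => F (w, b)) a ≠ 0 → deriv φ a ≠ 0) := by
  have hd : HasFDerivAt F (fderiv ℂ F (a, b)) (a, b) :=
    (hF.contDiffAt.differentiableAt (by simp)).hasFDerivAt
  have hd2 : HasDerivAt (fun z => F (a, z)) (fderiv ℂ F (a, b) (0, 1)) b :=
    hd.comp_hasDerivAt b ((hasDerivAt_const b a).prodMk (hasDerivAt_id b))
  have hinv : (fderiv ℂ F (a, b) ∘L .inr ℂ ℂ ℂ).IsInvertible := by
    rw [hd2.deriv] at h2
    refine ⟨ContinuousLinearEquiv.unitsEquivAut ℂ (Units.mk0 _ h2), ?_⟩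
    ext
    simp
  have hc : ContDiffAt ℂ ω F (a, b) := hF.contDiffAt
  have hφ := hc.contDiffAt_implicitFunction (by simp) hinv
  have hφ0 := hc.implicitFunction_apply_self (by simp) hinv
  have hφ1 := hc.eventually_apply_eq_iff_implicitFunction (by simp) hinv
  have hφ2 := hc.eventually_apply_implicitFunction (by simp) hinv
  set φ := hc.implicitFunction (by simp) hinv
  refine ⟨φ, hφ.analyticAt, hφ0, by simpa [h0] using hφ1, fun h1 h3 => h1 ?_⟩
  -- If `φ' = 0` at `a`, the constant function `F (w, φ w)` and `F (w, b)` have the same derivative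
  -- there, so the partial derivative in the first variable vanishes.
  have hφd : HasDerivAt φ 0 a := h3 ▸ hφ.analyticAt.differentiableAt.hasDerivAt
  have hb : φ a = b := hφ0
  have e1 : HasDerivAt (fun w => F (w, φ w)) (fderiv ℂ F (a, b) (1, 0)) a :=
    (hb ▸ hd : HasFDerivAt F (fderiv ℂ F (a, b)) (a, φ a)).comp_hasDerivAt a
      ((hasDerivAt_id a).prodMk hφd)
  have e2 : HasDerivAt (fun w => F (w, φ w)) 0 a :=
    (hasDerivAt_const a (F (a, b))).congr_of_eventuallyEq hφ2
  have e3 : HasDerivAt (fun w => F (w, b)) (fderiv ℂ F (a, b) (1, 0)) a :=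
    hd.comp_hasDerivAt a ((hasDerivAt_id a).prodMk (hasDerivAt_const a b))
  rw [e3.deriv, e1.unique e2]

/-- The arguments of `γ` and `z` sum to a number strictly between `0` and `π`, so they add without
wrapping around. -/
theorem im_mul_pos {σ₁ σ₂ : ℝ} (h₁ : 0 ≤ σ₁) (h₂ : 0 ≤ σ₂) {γ z : ℂ}
    (hγ : γ ∈ couplingSector σ₁ σ₂) (hγ0 : γ ≠ 0) (hz0 : z ≠ 0) (hz1 : -σ₁ ≤ z.arg)
    (hz2 : z.arg ≤ σ₂) : 0 < (γ * z).im := by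
  obtain hγ | ⟨-, hγ1, hγ2⟩ := hγ
  · exact absurd hγ hγ0
  have hpi := Real.pi_pos
  have harg : (γ * z).arg = γ.arg + z.arg :=
    (Complex.arg_mul_eq_add_arg_iff hγ0 hz0).2 ⟨by linarith, by linarith⟩
  have hs : 0 < Real.sin (γ * z).arg :=
    Real.sin_pos_of_pos_of_lt_pi (by linarith) (by linarith)
  rw [Complex.sin_arg] at hs
  exact (div_pos_iff_of_pos_right (norm_pos_iff.2 (mul_ne_zero hγ0 hz0))).1 hs

/-! ### Consequences of sectoriality and cyclicity. -/

section Sectorial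

variable {H : Type*} [NormedAddCommGroup H] [InnerProductSpace ℂ H]

/-- A zero of a nonnegative quadratic form is a minimum: moving from `f` in the direction `T f`
changes the form to first order by `2 t ‖T f‖ ^ 2`. -/
theorem apply_eq_zero_of_inner_eq_zero {T : H →ₗ[ℂ] H} (hT : T.IsSymmetric)
    (hpos : ∀ x, 0 ≤ (inner ℂ x (T x)).re) {f : H} (hf : inner ℂ f (T f) = 0) : T f = 0 := by
  by_contra hne
  have hn : 0 < ‖T f‖ ^ 2 := by positivity
  set c := (inner ℂ (T f) (T (T f))).re with hc
  have key : ∀ t : ℝ, 0 ≤ 2 * t * ‖T f‖ ^ 2 + t ^ 2 * c := fun t => by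
    have h := hpos (f + (t : ℂ) • T f)
    have e : inner ℂ (T f) (T f) = ((‖T f‖ ^ 2 : ℝ) : ℂ) := by
      rw [inner_self_eq_norm_sq_to_K]; norm_cast
    have e2 : inner ℂ f (T (T f)) = ((‖T f‖ ^ 2 : ℝ) : ℂ) := by rw [← hT f (T f), e]
    simp only [map_add, map_smul, inner_add_left, inner_add_right, inner_smul_left,
      inner_smul_right, hf, e, e2, Complex.conj_ofReal, Complex.add_re, Complex.re_ofReal_mul,
      Complex.ofReal_re, Complex.zero_re] at h
    rw [← hc] at h
    linarith
  have hc0 : 0 ≤ c := hpos _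
  -- The minimiser would be `-‖T f‖ ^ 2 / c`; the denominator `c + 1` avoids the case `c = 0`.
  have h1 := key (-(‖T f‖ ^ 2) / (c + 1))
  have e : 2 * (-(‖T f‖ ^ 2) / (c + 1)) * ‖T f‖ ^ 2 + (-(‖T f‖ ^ 2) / (c + 1)) ^ 2 * c
      = -(‖T f‖ ^ 2) ^ 2 * (c + 2) / (c + 1) ^ 2 := by
    field_simp
    ring
  rw [e] at h1
  have : 0 < (‖T f‖ ^ 2) ^ 2 * (c + 2) / (c + 1) ^ 2 := by positivity
  rw [neg_mul, neg_div] at h1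
  linarith

variable {A B : H →ₗ[ℂ] H} {σ₁ σ₂ : ℝ}

theorem IsSectorial.im_nonneg (hB : IsSectorial B σ₁ σ₂) {γ : ℂ}
    (hγ : γ ∈ couplingSector σ₁ σ₂) (f : H) : 0 ≤ (γ * inner ℂ f (B f)).im := by
  by_cases hγ0 : γ = 0
  · simp [hγ0]
  by_cases hz : inner ℂ f (B f) = 0
  · simp [hz]
  obtain h | ⟨h1, h2⟩ := hB.numericalRange f
  · exact absurd h hz
  · exact (im_mul_pos hB.nonneg₁ hB.nonneg₂ hγ hγ0 hz h1 h2).le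

theorem IsSectorial.im_pos (hB : IsSectorial B σ₁ σ₂) {γ : ℂ}
    (hγ : γ ∈ couplingSector σ₁ σ₂) (hγ0 : γ ≠ 0) {f : H} (hf : inner ℂ f (B f) ≠ 0) :
    0 < (γ * inner ℂ f (B f)).im := by
  obtain h | ⟨h1, h2⟩ := hB.numericalRange f
  · exact absurd h hf
  · exact im_mul_pos hB.nonneg₁ hB.nonneg₂ hγ hγ0 hf h1 h2

variable [FiniteDimensional ℂ H]

/-- The operator `-i (γ B - conj γ B*)` is symmetric, nonnegative by sectoriality, and its form
vanishes at `f`, so it kills `f`. -/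
theorem IsSectorial.smul_apply_eq (hB : IsSectorial B σ₁ σ₂) {γ : ℂ}
    (hγ : γ ∈ couplingSector σ₁ σ₂) {f : H} (hf : inner ℂ f (B f) = 0) :
    γ • B f = (starRingEnd ℂ γ) • LinearMap.adjoint B f := by
  have hf' : inner ℂ f (LinearMap.adjoint B f) = 0 := by
    rw [LinearMap.adjoint_inner_right, ← inner_conj_symm, hf, map_zero]
  set T : H →ₗ[ℂ] H := (-Complex.I * γ) • B + (Complex.I * starRingEnd ℂ γ) • LinearMap.adjoint B
    with hTdef
  have hT : T.IsSymmetric := fun x y => by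
    simp only [hTdef, LinearMap.add_apply, LinearMap.smul_apply, inner_add_left, inner_add_right,
      inner_smul_left, inner_smul_right, LinearMap.adjoint_inner_left,
      LinearMap.adjoint_inner_right, map_mul, map_neg, Complex.conj_I, Complex.conj_conj]
    ring
  have h0 : T f = 0 := by
    refine apply_eq_zero_of_inner_eq_zero hT (fun x => ?_) ?_
    · have h := hB.im_nonneg hγ x
      have e : inner ℂ x (LinearMap.adjoint B x) = starRingEnd ℂ (inner ℂ x (B x)) := by
        rw [LinearMap.adjoint_inner_right, inner_conj_symm]
      simp only [hTdef, LinearMap.add_apply, LinearMap.smul_apply, inner_add_right,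
        inner_smul_right, e]
      simp only [Complex.mul_im, Complex.add_re, Complex.mul_re, Complex.neg_re, Complex.I_re,
        Complex.neg_im, Complex.I_im, Complex.conj_re, Complex.conj_im] at h ⊢
      linarith
    · simp [hTdef, inner_smul_right, hf, hf']
  have h1 : Complex.I • T f = γ • B f - starRingEnd ℂ γ • LinearMap.adjoint B f := by
    simp only [hTdef, LinearMap.add_apply, LinearMap.smul_apply, smul_add, smul_smul]
    rw [sub_eq_add_neg, ← neg_smul]
    congr 2
    · linear_combination (-γ) * Complex.I_mul_I
    · linear_combination (starRingEnd ℂ γ) * Complex.I_mul_I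
  rw [h0, smul_zero] at h1
  exact (sub_eq_zero.1 h1.symm)

/-- Two directions in the sector suffice: `γ = i` gives `B* f = -B f`, and then `γ = exp (iθ)` with
`σ₁ < θ < π / 2` gives `2 cos θ • B f = 0`. -/
theorem IsSectorial.apply_eq_zero (hB : IsSectorial B σ₁ σ₂) {f : H}
    (hf : inner ℂ f (B f) = 0) : B f = 0 ∧ LinearMap.adjoint B f = 0 := by
  have hpi := Real.pi_pos
  have l1 := hB.lt₁
  have l2 := hB.lt₂
  have n1 := hB.nonneg₁
  have n2 := hB.nonneg₂
  set θ : ℝ := (σ₁ + Real.pi / 2) / 2 with hθ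
  have hI : Complex.I ∈ couplingSector σ₁ σ₂ :=
    Or.inr ⟨Complex.I_ne_zero, by rw [Complex.arg_I]; exact l1, by rw [Complex.arg_I]; linarith⟩
  have harg : (Complex.exp (θ * Complex.I)).arg = θ := by
    rw [Complex.arg_exp_mul_I, toIocMod_eq_self]
    exact ⟨by linarith, by linarith⟩
  have hE : Complex.exp (θ * Complex.I) ∈ couplingSector σ₁ σ₂ :=
    Or.inr ⟨Complex.exp_ne_zero _, by rw [harg]; linarith, by rw [harg]; linarith⟩
  have e1 := hB.smul_apply_eq hI hf
  have e2 := hB.smul_apply_eq hE hf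
  have e3 : LinearMap.adjoint B f = - B f := by
    rw [Complex.conj_I, neg_smul, ← smul_neg] at e1
    have := smul_right_injective H Complex.I_ne_zero e1
    rw [this, neg_neg]
  rw [e3, smul_neg, eq_neg_iff_add_eq_zero, ← add_smul, Complex.add_conj] at e2
  have hc : (Complex.exp (θ * Complex.I)).re ≠ 0 := by
    rw [Complex.exp_ofReal_mul_I_re]
    exact (Real.cos_pos_of_mem_Ioo ⟨by linarith, by linarith⟩).ne'
  have h0 : B f = 0 := by
    refine (smul_eq_zero.1 e2).resolve_left ?_
    exact_mod_cast mul_ne_zero two_ne_zero hc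
  exact ⟨h0, by rw [e3, h0, neg_zero]⟩

theorem IsSectorial.adjoint_apply_eq_zero (hB : IsSectorial B σ₁ σ₂) {f : H} (hf : B f = 0) :
    LinearMap.adjoint B f = 0 :=
  (hB.apply_eq_zero (by rw [hf, inner_zero_right])).2

theorem IsSectorial.inner_eq_zero (hB : IsSectorial B σ₁ σ₂) {k : H} (hk : B k = 0) (x : H) :
    inner ℂ k (B x) = 0 := by
  rw [← LinearMap.adjoint_inner_left, hB.adjoint_apply_eq_zero hk, inner_zero_left]

/-- Symmetry moves each power of `A` onto `f`, where it acts as a scalar, and `B* f = 0`; so `f` is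
orthogonal to the whole cyclic span. -/
theorem eq_zero_of_apply_eq (hA : A.IsSymmetric) (hB : IsSectorial B σ₁ σ₂)
    (hcyc : IsCyclicFor B A) {f : H} {μ : ℂ} (hf : A f = μ • f) (hBf : B f = 0) : f = 0 := by
  have h : f ∈ (Submodule.span ℂ {w : H | ∃ (n : ℕ) (v : H), w = (A ^ n) (B v)})ᗮ := by
    rw [Submodule.mem_orthogonal']
    intro u hu
    induction hu using Submodule.span_induction with
    | mem u hu =>
      obtain ⟨n, v, rfl⟩ := hu
      have : ∀ n : ℕ, inner ℂ f ((A ^ n) (B v)) = 0 := fun n => by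
        induction n with
        | zero => exact hB.inner_eq_zero hBf v
        | succ n ih =>
          rw [pow_succ', Module.End.mul_apply, ← hA, hf, inner_smul_left, ih, mul_zero]
      exact this n
    | zero => exact inner_zero_right _
    | add x y _ _ hx hy => rw [inner_add_right, hx, hy, add_zero]
    | smul c x _ hx => rw [inner_smul_right, hx, mul_zero]
  rw [hcyc, Submodule.top_orthogonal_eq_bot] at h
  simpa using h

/-- Pair the eigenvector equation with `f` and take imaginary parts; the term from `A` is real, and
the term from `γ B` is positive. -/
theorem im_pos_of_mem_spectrum (hA : A.IsSymmetric) (hB : IsSectorial B σ₁ σ₂)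
    (hcyc : IsCyclicFor B A) {γ : ℂ} (hγ : γ ∈ couplingSector σ₁ σ₂) (hγ0 : γ ≠ 0) {μ : ℂ}
    (hμ : μ ∈ spectrum ℂ (A + γ • B)) : 0 < μ.im := by
  rw [← Module.End.hasEigenvalue_iff_mem_spectrum] at hμ
  obtain ⟨f, hf⟩ := hμ.exists_hasEigenvector
  have hfe : A f + γ • B f = μ • f := by simpa using hf.apply_eq_smul
  have hin : inner ℂ f (B f) ≠ 0 := fun h => by
    have h0 := (hB.apply_eq_zero h).1
    rw [h0, smul_zero, add_zero] at hfe
    exact hf.2 (eq_zero_of_apply_eq hA hB hcyc hfe h0)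
  have h1 := congrArg (fun x => (inner ℂ f x).im) hfe
  simp only [inner_add_right, inner_smul_right] at h1
  have hr : (inner ℂ f (A f)).im = 0 := by
    have := hA.im_inner_self_apply f
    simpa using this
  have hn : inner ℂ f f = ((‖f‖ ^ 2 : ℝ) : ℂ) := by
    rw [inner_self_eq_norm_sq_to_K]; norm_cast
  rw [Complex.add_im, hr, zero_add, hn, Complex.im_mul_ofReal] at h1
  have h2 := hB.im_pos hγ hγ0 hin
  rw [h1] at h2
  have : 0 < ‖f‖ ^ 2 := by have := hf.2; positivity
  exact (pos_iff_pos_of_mul_pos h2).2 this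

/-- At the coupling constant `0` an eigenvalue moves with non-zero speed. -/
theorem deriv_detFun_zero_ne_zero (hA : A.IsSymmetric) (hB : IsSectorial B σ₁ σ₂)
    (hcyc : IsCyclicFor B A) {a : ℝ} (ha : (a : ℂ) ∈ spectrum ℂ A)
    (hs : IsSimpleEigenvalue A (a : ℂ)) :
    deriv (fun w => detFun A B w a) 0 ≠ 0 := by
  rw [← Module.End.hasEigenvalue_iff_mem_spectrum] at ha
  obtain ⟨f₀, hf₀⟩ := ha.exists_hasEigenvector
  obtain ⟨f, hfn, hfe, hf1⟩ : ∃ f : H, ‖f‖ = 1 ∧ A f = (a : ℂ) • f ∧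
      ∀ x, A x = (a : ℂ) • x → ∃ c : ℂ, x = c • f := by
    have hn : ‖f₀‖ ≠ 0 := norm_ne_zero_iff.2 hf₀.2
    refine ⟨((‖f₀‖⁻¹ : ℝ) : ℂ) • f₀, ?_, ?_, fun x hx => ?_⟩
    · rw [norm_smul, Complex.norm_real, norm_inv, norm_norm, inv_mul_cancel₀ hn]
    · rw [map_smul, hf₀.apply_eq_smul, smul_comm]
    · have hle := LinearMap.finrank_eigenspace_le A (a : ℂ)
      rw [show A.charpoly.rootMultiplicity (a : ℂ) = 1 from hs] at hle
      have hx' : x ∈ Module.End.eigenspace A (a : ℂ) := Module.End.mem_eigenspace_iff.2 hx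
      obtain ⟨v, hv⟩ := finrank_le_one_iff.1 hle
      obtain ⟨c, hc⟩ := hv ⟨x, hx'⟩
      obtain ⟨d, hd⟩ := hv ⟨f₀, hf₀.1⟩
      replace hc : c • (v : H) = x := congrArg Subtype.val hc
      replace hd : d • (v : H) = f₀ := congrArg Subtype.val hd
      have hd0 : d ≠ 0 := fun h => hf₀.2 (by rw [← hd, h, zero_smul])
      have hn' : (‖f₀‖ : ℂ) ≠ 0 := by exact_mod_cast hn
      refine ⟨c * d⁻¹ * ‖f₀‖, ?_⟩
      rw [smul_smul, ← hd, smul_smul, ← hc]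
      congr 1
      rw [hd]
      push_cast
      field_simp
  have hff : inner ℂ f f = 1 := by
    rw [inner_self_eq_norm_sq_to_K, hfn]; norm_num
  set ℓ : Module.Dual ℂ H := (innerₛₗ ℂ f : H →ₗ[ℂ] ℂ) with hℓ
  have hℓa : ∀ x, ℓ x = inner ℂ f x := fun x => rfl
  set P : H →ₗ[ℂ] H := ℓ.smulRight f with hP
  have hPa : ∀ x, P x = inner ℂ f x • f := fun x => rfl
  set A' : H →ₗ[ℂ] H := A - (a : ℂ) • (1 : H →ₗ[ℂ] H) with hA'
  have hPA : ∀ x, inner ℂ f (A' x) = 0 := fun x => by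
    rw [hA', LinearMap.sub_apply, LinearMap.smul_apply, Module.End.one_apply, inner_sub_right,
      ← hA f x, hfe, inner_smul_left, inner_smul_right, Complex.conj_ofReal, sub_self]
  -- `A'` has no component along `f`, so the `f`-component of `A' + w B` carries a factor `w`. `C w`
  -- is the operator with that factor removed; the transvection restores it and has determinant `w`.
  -- The derivative sought is thus `det (C 0)`.
  set C : ℂ → H →ₗ[ℂ] H := fun w => A' + w • (B - P ∘ₗ B) + P ∘ₗ B with hC
  have hfac : ∀ w, detFun A B w a = w * LinearMap.det (C w) := fun w => by
    have h1 : A + w • B - (a : ℂ) • (1 : H →ₗ[ℂ] H) =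
        LinearMap.transvection ((w - 1) • ℓ) f ∘ₗ C w := by
      ext x
      simp only [hC, LinearMap.transvection, LinearMap.comp_apply, LinearMap.add_apply,
        LinearMap.sub_apply, LinearMap.smul_apply, Module.End.one_apply]
      simp [hℓa, hPa, hPA, hfn]
      simp only [hA', LinearMap.sub_apply, LinearMap.smul_apply, Module.End.one_apply]
      module
    rw [detFun, h1, LinearMap.det_comp, LinearMap.transvection.det]
    simp [hℓa, hfn]
  have hC0 : LinearMap.det (C 0) ≠ 0 := fun h0 => by
    rw [LinearMap.det_eq_zero_iff_ker_ne_bot] at h0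
    obtain ⟨x, hx, hx0⟩ := Submodule.exists_mem_ne_zero_of_ne_bot h0
    have hx' : A' x + inner ℂ f (B x) • f = 0 := by
      simpa [hC, hPa] using hx
    have h1 : inner ℂ f (B x) = 0 := by
      have := congrArg (inner ℂ f) hx'
      simpa [inner_add_right, hPA, inner_smul_right, hfn] using this
    rw [h1, zero_smul, add_zero] at hx'
    obtain ⟨c, rfl⟩ := hf1 x (by simpa [hA', sub_eq_zero] using hx')
    have hc : c ≠ 0 := fun h => hx0 (by rw [h, zero_smul])
    rw [map_smul, inner_smul_right] at h1
    have h2 := (hB.apply_eq_zero ((mul_eq_zero.1 h1).resolve_left hc)).1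
    have := eq_zero_of_apply_eq hA hB hcyc hfe h2
    rw [this, norm_zero] at hfn
    exact zero_ne_one hfn
  have hCd : DifferentiableAt ℂ (fun w => LinearMap.det (C w)) 0 := by
    refine (contDiff_det (n := 1) C fun v => ?_).contDiffAt.differentiableAt (by simp)
    simp only [hC, LinearMap.add_apply, LinearMap.smul_apply]
    fun_prop
  have hd := (hasDerivAt_id (0 : ℂ)).mul hCd.hasDerivAt
  simp only [id, one_mul, zero_mul, add_zero] at hd
  have : (fun w => detFun A B w a) = (id * fun w => LinearMap.det (C w)) := by
    ext w; exact hfac w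
  rw [this]
  simpa using hd.deriv ▸ hC0

end Sectorial

/-! ### Continuous listings of finite-valued multifunctions. -/

theorem continuous_of_isClosed_preimage_singleton {X ι : Type*} [TopologicalSpace X]
    [TopologicalSpace ι] [DiscreteTopology ι] [Finite ι] {f : X → ι}
    (h : ∀ i, IsClosed (f ⁻¹' {i})) : Continuous f := by
  refine continuous_iff_isClosed.2 fun s _ => ?_
  rw [← biUnion_of_singleton s, preimage_iUnion₂]
  exact s.toFinite.isClosed_biUnion fun i _ => h i

/-- A multivalued function on the line that is locally listed by `N` continuous functions with
distinct values has, through any listing of one fibre, a global continuous listing. -/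
theorem exists_continuous_listing {N : ℕ} (Z : ℝ → Set ℂ)
    (hZ : ∀ t₀, ∃ h : Fin N → ℝ → ℂ, ∀ᶠ t in 𝓝 t₀, (∀ i, ContinuousAt (h i) t) ∧
      (Function.Injective fun i => h i t) ∧ Z t = range fun i => h i t)
    (a : Fin N → ℂ) (ha : Function.Injective a) (ha0 : ∀ i, a i ∈ Z 0) :
    ∃ lam : Fin N → ℝ → ℂ, (∀ i, Continuous (lam i)) ∧ (∀ i, lam i 0 = a i) ∧
      (∀ t, Function.Injective fun i => lam i t) ∧ ∀ t, Z t = range fun i => lam i t := by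
  -- The graph of `Z`, whose projection to the line is a covering; the curves are the lifts of the
  -- identity through the points `a i`.
  let E := {p : ℝ × ℂ // p.2 ∈ Z p.1}
  let q : E → ℝ := fun p => p.1.1
  have hq : Continuous q := continuous_fst.comp continuous_subtype_val
  have hcov : IsCoveringMap q := by
    rw [isCoveringMap_iff_isCoveringMapOn_univ]
    intro t₀ _
    refine IsEvenlyCovered.to_isEvenlyCovered_preimage (I := Fin N) ⟨inferInstance, ?_⟩
    obtain ⟨h, hh⟩ := hZ t₀
    obtain ⟨U, hU, hUo, htU⟩ := eventually_nhds_iff.1 hh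
    have hcont : ∀ i, ContinuousOn (h i) U := fun i t ht => ((hU t ht).1 i).continuousWithinAt
    have hinj : ∀ t ∈ U, Function.Injective fun i => h i t := fun t ht => (hU t ht).2.1
    have hrange : ∀ t ∈ U, Z t = range fun i => h i t := fun t ht => (hU t ht).2.2
    refine ⟨U, htU, hUo, hUo.preimage hq, ?_⟩
    have hidx : ∀ e : q ⁻¹' U, ∃ i, h i e.1.1.1 = e.1.1.2 := fun e => by
      have := e.1.2
      rw [hrange _ e.2] at this
      exact this
    choose idx hidx using hidx
    have hidxc : Continuous idx := by
      have hclosed : ∀ i, IsClosed (idx ⁻¹' {i}) := fun i => by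
        have he : idx ⁻¹' {i} = {e : q ⁻¹' U | h i e.1.1.1 = e.1.1.2} := by
          ext e
          constructor
          · rintro rfl
            exact hidx e
          · intro he
            exact hinj _ e.2 ((hidx e).trans (Eq.symm he))
        rw [he]
        have hc : Continuous fun e : q ⁻¹' U => e.1.1 :=
          continuous_subtype_val.comp continuous_subtype_val
        exact isClosed_eq ((hcont i).comp_continuous (continuous_fst.comp hc) fun e => e.2)
          (continuous_snd.comp hc)
      exact continuous_of_isClosed_preimage_singleton hclosed
    refine ⟨⟨⟨fun e => (⟨q e.1, e.2⟩, idx e), fun u =>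
      ⟨⟨(u.1, h u.2 u.1), by rw [hrange _ u.1.2]; exact ⟨u.2, rfl⟩⟩, u.1.2⟩, fun e => ?_,
      fun u => ?_⟩, ?_, ?_⟩, fun e => rfl⟩
    · apply Subtype.ext
      apply Subtype.ext
      exact Prod.ext rfl (hidx e)
    · refine Prod.ext rfl ?_
      exact hinj _ u.1.2 (hidx _)
    · exact ((hq.comp continuous_subtype_val).subtype_mk _).prodMk hidxc
    · refine Continuous.subtype_mk (Continuous.subtype_mk (Continuous.prodMk
        (continuous_subtype_val.comp continuous_fst)
        (g := fun v : U × Fin N => h v.2 v.1) ?_) _) _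
      rw [continuous_iff_continuousAt]
      rintro ⟨u, i⟩
      have h1 : ContinuousAt (fun v : U × Fin N => h i v.1) (u, i) :=
        ((hU u u.2).1 i).comp (f := fun v : U × Fin N => (v.1 : ℝ)) (by fun_prop)
      refine h1.congr ?_
      have : ∀ᶠ v : U × Fin N in 𝓝 (u, i), v.2 = i :=
        (continuous_snd.tendsto (u, i)).eventually ((isOpen_discrete {i}).mem_nhds rfl)
      filter_upwards [this] with v hv
      rw [hv]
  have hlift : ∀ i, ∃ F : C(ℝ, E), F 0 = ⟨(0, a i), ha0 i⟩ ∧ q ∘ F = ContinuousMap.id ℝ :=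
    fun i => (hcov.existsUnique_continuousMap_lifts (ContinuousMap.id ℝ) 0 ⟨(0, a i), ha0 i⟩
      rfl).exists
  choose F hF0 hF using hlift
  have hFt : ∀ i t, (F i t).1.1 = t := fun i t => congrFun (hF i) t
  have hinj : ∀ t, Function.Injective fun i => (F i t).1.2 := fun t i j hij => by
    have he : (F i : ℝ → E) = F j := by
      -- Lifts that meet at one time coincide, whereas these start at distinct points.
      refine hcov.eq_of_comp_eq (F i).continuous (F j).continuous ((hF i).trans (hF j).symm) t ?_
      exact Subtype.ext (Prod.ext ((hFt i t).trans (hFt j t).symm) hij)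
    have := congrFun he 0
    rw [hF0, hF0] at this
    exact ha (congrArg (fun e : E => e.1.2) this)
  refine ⟨fun i t => (F i t).1.2, fun i => continuous_snd.comp
    (continuous_subtype_val.comp (F i).continuous), fun i => by simp [hF0], hinj,
    fun t => ?_⟩
  have hsub : (range fun i => (F i t).1.2) ⊆ Z t := by
    rintro _ ⟨i, rfl⟩
    have := (F i t).2
    rwa [hFt] at this
  obtain ⟨h, hh⟩ := hZ t
  obtain ⟨-, hi, hr⟩ := hh.self_of_nhds
  have hc : (Z t).ncard ≤ (range fun i => (F i t).1.2).ncard := by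
    rw [hr, ← image_univ, ← image_univ, ncard_image_of_injective _ hi,
      ncard_image_of_injective _ (hinj t)]
  exact (eq_of_subset_of_ncard_le hsub hc (hr ▸ finite_range _)).symm

/-- Two continuous listings of the same finite sets over a half-line differ by a permutation. -/
theorem exists_perm_of_range_eq {N : ℕ} {f h : Fin N → ℝ → ℂ} {T : ℝ}
    (hf : ∀ i, ContinuousOn (f i) (Ici T)) (hh : ∀ i, ContinuousOn (h i) (Ici T))
    (hfi : ∀ t ∈ Ici T, Function.Injective fun i => f i t)
    (hhi : ∀ t ∈ Ici T, Function.Injective fun i => h i t)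
    (hr : ∀ t ∈ Ici T, ∀ i, h i t ∈ range fun j => f j t) :
    ∃ π : Equiv.Perm (Fin N), ∀ i, ∀ t ∈ Ici T, h i t = f (π i) t := by
  -- The index of the matching curve is continuous with values in a discrete set, hence constant on
  -- the connected half-line.
  have key : ∀ i, ∃ j, ∀ t ∈ Ici T, h i t = f j t := fun i => by
    have hidx : ∀ t : Ici T, ∃ j, f j t = h i t := fun t => hr t t.2 i
    choose idx hidx using hidx
    have hidxc : Continuous idx := by
      have hclosed : ∀ j, IsClosed (idx ⁻¹' {j}) := fun j => by
        have he : idx ⁻¹' {j} = {t : Ici T | f j t = h i t} := by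
          ext t
          constructor
          · rintro rfl
            exact hidx t
          · intro he
            exact hfi _ t.2 ((hidx t).trans (Eq.symm he))
        rw [he]
        exact isClosed_eq (hf j).domRestrict (hh i).domRestrict
      exact continuous_of_isClosed_preimage_singleton hclosed
    have : PreconnectedSpace (Ici T) := isPreconnected_iff_preconnectedSpace.1 isPreconnected_Ici
    refine ⟨idx ⟨T, self_mem_Ici⟩, fun t ht => ?_⟩
    rw [PreconnectedSpace.constant this hidxc (x := ⟨T, self_mem_Ici⟩) (y := ⟨t, ht⟩)]
    exact (hidx ⟨t, ht⟩).symm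
  choose σ hσ using key
  have hσi : Function.Injective σ := fun i j hij => by
    have h1 := hσ i T self_mem_Ici
    rw [hij, ← hσ j T self_mem_Ici] at h1
    exact hhi T self_mem_Ici h1
  exact ⟨Equiv.ofBijective σ (Finite.injective_iff_bijective.1 hσi), hσ⟩

theorem eventually_injective {X ι : Type*} [Finite ι] {l : Filter X} {f : ι → X → ℂ} {a : ι → ℂ}
    (ha : Function.Injective a) (hf : ∀ i, Tendsto (f i) l (𝓝 (a i))) :
    ∀ᶠ x in l, Function.Injective fun i => f i x := by
  have h : ∀ i j, ∀ᶠ x in l, f i x = f j x → i = j := fun i j => by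
    by_cases hij : i = j
    · simp [hij]
    · filter_upwards [((hf i).sub (hf j)).eventually_ne (sub_ne_zero.2 fun h => hij (ha h))]
        with x hx hx'
      exact absurd (sub_eq_zero.2 hx') hx
  filter_upwards [eventually_all.2 fun i => eventually_all.2 fun j => h i j] with x hx i j hij
  exact hx i j hij

/-! ### Local holomorphic branches of the spectrum. -/

section Listing

variable {H : Type*} [NormedAddCommGroup H] [InnerProductSpace ℂ H] [FiniteDimensional ℂ H]
variable {A B : H →ₗ[ℂ] H}

theorem ncard_spectrum_le (T : H →ₗ[ℂ] H) : (spectrum ℂ T).ncard ≤ Module.finrank ℂ H := by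
  rw [spectrum_eq_coe_toFinset_roots, ncard_coe_finset, ← LinearMap.charpoly_natDegree T]
  exact (Multiset.toFinset_card_le _).trans (Polynomial.card_roots' _)

theorem spectrum_eq_range {T : H →ₗ[ℂ] H} {N : ℕ} (hN : Module.finrank ℂ H = N) {f : Fin N → ℂ}
    (hf : Function.Injective f) (hfT : ∀ i, f i ∈ spectrum ℂ T) : spectrum ℂ T = range f := by
  refine (eq_of_subset_of_ncard_le (range_subset_iff.2 hfT) ?_ (Module.End.finite_spectrum T)).symm
  rw [← image_univ, ncard_image_of_injective _ hf, ncard_univ, Nat.card_eq_fintype_card,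
    Fintype.card_fin, ← hN]
  exact ncard_spectrum_le T

/-- The implicit branches through the `N` simple eigenvalues stay distinct near `γ₀`, and the
spectrum has room for no others. -/
theorem exists_local_listing {N : ℕ} (hN : Module.finrank ℂ H = N) {γ₀ : ℂ}
    (hs : ∀ z ∈ spectrum ℂ (A + γ₀ • B), IsSimpleEigenvalue (A + γ₀ • B) z) :
    ∃ φ : Fin N → ℂ → ℂ, ∀ᶠ γ in 𝓝 γ₀, (∀ i, ContinuousAt (φ i) γ) ∧
      (Function.Injective fun i => φ i γ) ∧ spectrum ℂ (A + γ • B) = range fun i => φ i γ := by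
  have hcard : Nat.card (spectrum ℂ (A + γ₀ • B)) = N := by
    rw [Nat.card_coe_set_eq, ncard_spectrum hs, hN]
  have : Finite (spectrum ℂ (A + γ₀ • B)) := Module.End.finite_spectrum _
  let e : spectrum ℂ (A + γ₀ • B) ≃ Fin N := Finite.equivFinOfCardEq hcard
  have h : ∀ i, ∃ φ : ℂ → ℂ, AnalyticAt ℂ φ γ₀ ∧ φ γ₀ = (e.symm i : ℂ) ∧
      ∀ᶠ v in 𝓝 (γ₀, (e.symm i : ℂ)), detFun A B v.1 v.2 = 0 ↔ φ v.1 = v.2 := fun i => by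
    obtain ⟨φ, h1, h2, h3, -⟩ := exists_implicit (contDiff_detFun A B)
      ((mem_spectrum_iff_detFun A B γ₀ _).1 (e.symm i).2)
      (deriv_detFun_ne_zero (hs _ (e.symm i).2))
    exact ⟨φ, h1, h2, h3⟩
  choose φ hφ hφ0 hφ1 using h
  refine ⟨φ, ?_⟩
  have e1 : ∀ᶠ γ in 𝓝 γ₀, ∀ i, ContinuousAt (φ i) γ := eventually_all.2 fun i =>
    (hφ i).eventually_analyticAt.mono fun _ h => h.continuousAt
  have e2 : ∀ᶠ γ in 𝓝 γ₀, Function.Injective fun i => φ i γ :=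
    eventually_injective (a := fun i => (e.symm i : ℂ))
      (Subtype.val_injective.comp e.symm.injective)
      fun i => hφ0 i ▸ (hφ i).continuousAt
  have e3 : ∀ᶠ γ in 𝓝 γ₀, ∀ i, φ i γ ∈ spectrum ℂ (A + γ • B) := eventually_all.2 fun i => by
    have ht : Tendsto (fun γ => (γ, φ i γ)) (𝓝 γ₀) (𝓝 (γ₀, (e.symm i : ℂ))) := by
      rw [← hφ0 i]
      exact continuousAt_id.prodMk (hφ i).continuousAt
    filter_upwards [ht.eventually (hφ1 i)] with γ hγ
    exact (mem_spectrum_iff_detFun A B γ _).2 (hγ.2 rfl)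
  filter_upwards [e1, e2, e3] with γ h1 h2 h3
  exact ⟨h1, h2, spectrum_eq_range hN h2 h3⟩

end Listing

/-! ### Eigenvalues for large coupling, with `s = 1 / γ`. -/

section LargeCoupling

variable {H : Type*} [NormedAddCommGroup H] [InnerProductSpace ℂ H] [FiniteDimensional ℂ H]
variable {A B : H →ₗ[ℂ] H} {σ₁ σ₂ : ℝ}

theorem eventually_implicit_eq_zero {F : ℂ × ℂ → ℂ} {φ : ℂ → ℂ} {a b : ℂ}
    (hφ : AnalyticAt ℂ φ a) (hφ0 : φ a = b)
    (h : ∀ᶠ v in 𝓝 (a, b), F v = 0 ↔ φ v.1 = v.2) : ∀ᶠ s in 𝓝 a, F (s, φ s) = 0 := by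
  have ht : Tendsto (fun s => (s, φ s)) (𝓝 a) (𝓝 (a, b)) := by
    rw [← hφ0]
    exact continuousAt_id.prodMk hφ.continuousAt
  filter_upwards [ht.eventually h] with s hs
  exact hs.2 rfl

/-- A simple eigenvalue `β` of `B` yields eigenvalues of `A + s⁻¹ B` asymptotic to `β / s`. -/
theorem exists_large_eigenvalue {b : ℂ} (hb : b ∈ spectrum ℂ B) (hs : IsSimpleEigenvalue B b) :
    ∃ ψ : ℂ → ℂ, AnalyticAt ℂ ψ 0 ∧ ψ 0 = b ∧
      ∀ᶠ s in 𝓝 0, s ≠ 0 → ψ s / s ∈ spectrum ℂ (A + s⁻¹ • B) := by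
  have e0 : B + (0 : ℂ) • A = B := by rw [zero_smul, add_zero]
  obtain ⟨ψ, h1, h2, h3, -⟩ := exists_implicit (contDiff_detFun B A) (a := 0) (b := b)
    ((mem_spectrum_iff_detFun B A 0 b).1 (e0.symm ▸ hb))
    (deriv_detFun_ne_zero (e0.symm ▸ hs))
  refine ⟨ψ, h1, h2, ?_⟩
  filter_upwards [eventually_implicit_eq_zero h1 h2 h3] with s hs hs0
  rw [mem_spectrum_iff_detFun, detFun]
  have : A + s⁻¹ • B - (ψ s / s) • (1 : H →ₗ[ℂ] H) = s⁻¹ • (B + s • A - ψ s • 1) := by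
    rw [smul_sub, smul_add, smul_smul, smul_smul, inv_mul_cancel₀ hs0, one_smul, add_comm A,
      div_eq_inv_mul]
  rw [this, LinearMap.det_smul]
  exact mul_eq_zero_of_right _ hs

/-- A simple eigenvalue `d` of the truncation of `A` to `ker B` is a limit of eigenvalues of
`A + s⁻¹ B` as `s → 0`. -/
theorem exists_bounded_eigenvalue (hB : IsSectorial B σ₁ σ₂) {d : ℂ}
    (hd : d ∈ spectrum ℂ (truncation A (LinearMap.ker B)))
    (hs : IsSimpleEigenvalue (truncation A (LinearMap.ker B)) d) :
    ∃ χ : ℂ → ℂ, AnalyticAt ℂ χ 0 ∧ χ 0 = d ∧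
      ∀ᶠ s in 𝓝 0, s ≠ 0 → χ s ∈ spectrum ℂ (A + s⁻¹ • B) := by
  set K := LinearMap.ker B with hK
  set P : H →ₗ[ℂ] H := (K.starProjection : H →ₗ[ℂ] H) with hP
  have hPK : ∀ x, P x ∈ K := fun x => K.starProjection_apply_mem x
  have hPk : ∀ x ∈ K, P x = x := fun x hx => K.starProjection_eq_self_iff.2 hx
  have hPP : P * P = P := LinearMap.ext fun x => hPk _ (hPK x)
  have hPB : P * B = 0 := LinearMap.ext fun x => by
    refine (K.starProjection_apply_eq_zero_iff).2 ?_
    rw [Submodule.mem_orthogonal]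
    exact fun u hu => hB.inner_eq_zero hu x
  -- Since `P B = 0`, multiplying `A + s⁻¹ B - z` by `S s` turns `s⁻¹ B` into `B`. The product `D
  -- (s, z)` is regular at `s = 0`, and for `s ≠ 0` its determinant has the same zeros in `z`.
  set S : ℂ → H →ₗ[ℂ] H := fun s => P + s • (1 - P) with hS
  have hSS : ∀ s : ℂ, s ≠ 0 → LinearMap.det (S s) ≠ 0 := fun s hs0 h => by
    have h1 : S s * S s⁻¹ = 1 := by
      simp only [hS, mul_add, add_mul, mul_sub, sub_mul, mul_one, one_mul, smul_mul_assoc,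
        mul_smul_comm, hPP, sub_self, smul_zero]
      rw [add_zero, add_sub_cancel_left, inv_smul_smul₀ hs0, add_sub_cancel]
    have h2 := congrArg LinearMap.det h1
    rw [map_mul, h, zero_mul, map_one] at h2
    exact zero_ne_one h2
  set D : ℂ × ℂ → H →ₗ[ℂ] H := fun p => S p.1 * (A - p.2 • 1) + B with hD
  have hDc : ContDiff ℂ ω fun p => LinearMap.det (D p) := by
    refine contDiff_det D fun v => ?_
    simp only [hD, hS, hP, LinearMap.add_apply, Module.End.mul_apply, LinearMap.sub_apply,
      LinearMap.smul_apply, Module.End.one_apply, ContinuousLinearMap.coe_coe]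
    fun_prop
  have hDs : ∀ s z : ℂ, s ≠ 0 → LinearMap.det (D (s, z)) = LinearMap.det (S s) *
      detFun A B s⁻¹ z := fun s z hs0 => by
    rw [detFun, ← map_mul]
    congr 1
    have : S s * (s⁻¹ • B) = B := by
      simp only [hS, add_mul, sub_mul, smul_mul_assoc, mul_smul_comm, hPB, one_mul,
        smul_smul, inv_mul_cancel₀ hs0, sub_zero, zero_add, one_smul]
    have e : A + s⁻¹ • B - z • (1 : H →ₗ[ℂ] H) = (A - z • 1) + s⁻¹ • B := by abel
    rw [e, mul_add, this]
  have hBK : K ≤ K.comap B := fun x hx => by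
    rw [Submodule.mem_comap, show B x = 0 from hx]
    exact K.zero_mem
  set c := LinearMap.det (K.mapQ K B hBK) with hc
  -- The range of `B` is orthogonal to its kernel, so `B x ∈ K` forces `B x = 0`: the induced map on
  -- the quotient is injective.
  have hc0 : c ≠ 0 := fun h => by
    rw [hc, LinearMap.det_eq_zero_iff_ker_ne_bot] at h
    refine h ((Submodule.eq_bot_iff _).2 fun y hy => ?_)
    obtain ⟨x, rfl⟩ := K.mkQ_surjective y
    have hy' : B x ∈ K := by
      rw [LinearMap.mem_ker, Submodule.mkQ_apply, Submodule.mapQ_apply,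
        Submodule.Quotient.mk_eq_zero] at hy
      exact hy
    have : B x = 0 := inner_self_eq_zero.1 (hB.inner_eq_zero (k := B x) hy' x)
    rw [Submodule.mkQ_apply, Submodule.Quotient.mk_eq_zero]
    exact this
  -- At `s = 0` the operator is block triangular for `K`: the truncation minus `z` on `K`, and the
  -- map induced by `B` on the quotient.
  have hD0 : ∀ z : ℂ, LinearMap.det (D (0, z)) =
      LinearMap.det (truncation A K - z • (1 : K →ₗ[ℂ] K)) * c := fun z => by
    have hDz : ∀ x, D (0, z) x = P (A x - z • x) + B x := fun x => by
      simp [hD, hS]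
    have hDK : K ≤ K.comap (D (0, z)) := fun x hx => by
      rw [Submodule.mem_comap, hDz, show B x = 0 from hx, add_zero]
      exact hPK _
    rw [LinearMap.det_eq_det_mul_det K (D (0, z)) hDK]
    congr 2
    · ext x
      have hx : B x = 0 := x.2
      rw [LinearMap.coe_restrict_apply, hDz, hx, add_zero, map_sub, map_smul, hPk x x.2]
      simp [truncation, hP]
    · refine LinearMap.ext fun y => ?_
      obtain ⟨x, rfl⟩ := K.mkQ_surjective y
      rw [Submodule.mkQ_apply, Submodule.mapQ_apply, Submodule.mapQ_apply,
        Submodule.Quotient.eq, hDz, add_sub_cancel_right]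
      exact hPK _
  obtain ⟨χ, h1, h2, h3, -⟩ := exists_implicit hDc (a := 0) (b := d)
    (by rw [hD0, (mem_spectrum_iff_det _ _).1 hd, zero_mul])
    (by
      simp only [hD0, deriv_mul_const_field']
      exact mul_ne_zero (deriv_det_sub_ne_zero hs) hc0)
  refine ⟨χ, h1, h2, ?_⟩
  filter_upwards [eventually_implicit_eq_zero h1 h2 h3] with s hs hs0
  rw [hDs s _ hs0] at hs
  exact (mem_spectrum_iff_detFun A B _ _).2 ((mul_eq_zero.1 hs).resolve_left (hSS s hs0))

end LargeCoupling

/-! ### Eigenvalues along the coupling curve. -/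

section Main

variable {H : Type*} [NormedAddCommGroup H] [InnerProductSpace ℂ H] [FiniteDimensional ℂ H]
variable {A B : H →ₗ[ℂ] H} {σ₁ σ₂ : ℝ} {g : ℝ → ℂ}

theorem IsCouplingCurve.mem_couplingSector (hg : IsCouplingCurve A B σ₁ σ₂ g) {t : ℝ}
    (ht : 0 ≤ t) : g t ∈ couplingSector σ₁ σ₂ := by
  obtain rfl | ht := ht.eq_or_lt
  · exact Or.inl hg.map_zero
  · exact (hg.mem t ht).1

theorem IsCouplingCurve.isSimpleEigenvalue (hg : IsCouplingCurve A B σ₁ σ₂ g)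
    (hA_simple : ∀ μ ∈ spectrum ℂ A, IsSimpleEigenvalue A μ) {t : ℝ} (ht : 0 ≤ t) {z : ℂ}
    (hz : z ∈ spectrum ℂ (A + g t • B)) : IsSimpleEigenvalue (A + g t • B) z := by
  obtain rfl | ht := ht.eq_or_lt
  · rw [hg.map_zero, zero_smul, add_zero] at hz ⊢
    exact hA_simple z hz
  · by_contra h
    exact (hg.mem t ht).2 (Or.inl ⟨(hg.mem t ht).1, z, hz, h⟩)

theorem IsCouplingCurve.deriv_detFun_ne_zero (hg : IsCouplingCurve A B σ₁ σ₂ g)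
    (hA : A.IsSymmetric) (hB : IsSectorial B σ₁ σ₂) (hcyc : IsCyclicFor B A)
    (hA_simple : ∀ μ ∈ spectrum ℂ A, IsSimpleEigenvalue A μ)
    (hA_real : ∀ μ ∈ spectrum ℂ A, ∃ a : ℝ, (a : ℂ) = μ) {t : ℝ} (ht : 0 ≤ t) {z : ℂ}
    (hz : z ∈ spectrum ℂ (A + g t • B)) : deriv (fun w => detFun A B w z) (g t) ≠ 0 := by
  -- The split is on `g t`, not `t`: `0` lies in the sector, so the curve may return to it at a
  -- positive time.
  by_cases h0 : g t = 0
  · rw [h0, zero_smul, add_zero] at hz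
    obtain ⟨a, rfl⟩ := hA_real z hz
    rw [h0]
    exact deriv_detFun_zero_ne_zero hA hB hcyc hz (hA_simple _ hz)
  · have ht' : 0 < t := ht.lt_of_ne fun h => h0 (h ▸ hg.map_zero)
    have hS := (hg.mem t ht').1
    exact fun h => (hg.mem t ht').2 (Or.inr ⟨hS, z, im_pos_of_mem_spectrum hA hB hcyc hS h0 hz,
      (mem_spectrum_iff_detFun A B _ _).1 hz, h⟩)

/-- A continuous choice of eigenvalues is locally a holomorphic function of the coupling. -/
theorem exists_analyticAt_eigenvalue {c : ℝ → ℂ} {t : ℝ} (hgt : ContinuousWithinAt g (Ici 0) t)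
    (ht : 0 ≤ t) (hc : ContinuousWithinAt c (Ici 0) t)
    (hmem : ∀ s, 0 ≤ s → c s ∈ spectrum ℂ (A + g s • B))
    (hs : IsSimpleEigenvalue (A + g t • B) (c t))
    (hd : deriv (fun w => detFun A B w (c t)) (g t) ≠ 0) :
    ∃ φ : ℂ → ℂ, AnalyticAt ℂ φ (g t) ∧ deriv φ (g t) ≠ 0 ∧ c =ᶠ[𝓝[Ici 0] t] φ ∘ g := by
  obtain ⟨φ, h1, -, h3, h4⟩ := exists_implicit (contDiff_detFun A B)
    ((mem_spectrum_iff_detFun A B _ _).1 (hmem t ht)) (deriv_detFun_ne_zero hs)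
  refine ⟨φ, h1, h4 hd, ?_⟩
  filter_upwards [(hgt.prodMk hc).eventually h3, self_mem_nhdsWithin] with s hs' hs0
  exact (hs'.1 ((mem_spectrum_iff_detFun A B _ _).1 (hmem s hs0))).symm

/-- The eigenvalues of `A + γ B` for `γ → ∞`, as continuous functions of `γ`. -/
theorem exists_asymptotic_eigenvalues (hB : IsSectorial B σ₁ σ₂) {M L : ℕ}
    {β : Fin M → ℂ} (hβ : Function.Injective β) (hβB : ∀ r, β r ∈ spectrum ℂ B)
    (hβ0 : ∀ r, β r ≠ 0) (hβs : ∀ r, IsSimpleEigenvalue B (β r))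
    {δ : Fin L → ℂ} (hδ : Function.Injective δ)
    (hδK : ∀ r, δ r ∈ spectrum ℂ (truncation A (LinearMap.ker B)))
    (hδs : ∀ r, IsSimpleEigenvalue (truncation A (LinearMap.ker B)) (δ r)) :
    ∃ h : Fin (M + L) → ℂ → ℂ,
      (∀ᶠ s in 𝓝[≠] (0 : ℂ), (∀ r, ContinuousAt (h r) s) ∧
        (Function.Injective fun r => h r s) ∧ ∀ r, h r s ∈ spectrum ℂ (A + s⁻¹ • B)) ∧
      (∀ r : Fin M, Tendsto (fun s => s * h (Fin.castAdd L r) s) (𝓝[≠] 0) (𝓝 (β r))) ∧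
      ∀ r : Fin L, Tendsto (h (Fin.natAdd M r)) (𝓝[≠] 0) (𝓝 (δ r)) := by
  choose ψ hψ hψ0 hψs using fun r => exists_large_eigenvalue (A := A) (hβB r) (hβs r)
  choose χ hχ hχ0 hχs using fun r => exists_bounded_eigenvalue hB (hδK r) (hδs r)
  have tψ : ∀ r, Tendsto (ψ r) (𝓝[≠] 0) (𝓝 (β r)) := fun r =>
    (hψ0 r ▸ (hψ r).continuousAt.tendsto).mono_left nhdsWithin_le_nhds
  have tχ : ∀ r, Tendsto (χ r) (𝓝[≠] 0) (𝓝 (δ r)) := fun r =>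
    (hχ0 r ▸ (hχ r).continuousAt.tendsto).mono_left nhdsWithin_le_nhds
  have hne : ∀ᶠ s in 𝓝[≠] (0 : ℂ), s ≠ 0 := self_mem_nhdsWithin
  refine ⟨Fin.addCases (fun r s => ψ r s / s) χ, ?_, fun r => ?_, fun r => ?_⟩
  · have e1 : ∀ᶠ s in 𝓝[≠] (0 : ℂ), ∀ r, ContinuousAt (ψ r) s := eventually_all.2 fun r =>
      ((hψ r).eventually_analyticAt.mono fun _ h => h.continuousAt).filter_mono nhdsWithin_le_nhds
    have e2 : ∀ᶠ s in 𝓝[≠] (0 : ℂ), ∀ r, ContinuousAt (χ r) s := eventually_all.2 fun r =>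
      ((hχ r).eventually_analyticAt.mono fun _ h => h.continuousAt).filter_mono nhdsWithin_le_nhds
    have e3 := eventually_injective hβ tψ
    have e4 := eventually_injective hδ tχ
    -- This separates the two families: `ψ i s` tends to `β i ≠ 0`, but `s * χ j s` tends to `0`.
    have e5 : ∀ᶠ s in 𝓝[≠] (0 : ℂ), ∀ i j, ψ i s ≠ s * χ j s :=
      eventually_all.2 fun i => eventually_all.2 fun j => by
        have h0 : Tendsto (fun s => s * χ j s) (𝓝[≠] 0) (𝓝 (0 * δ j)) :=
          (tendsto_id.mono_left nhdsWithin_le_nhds).mul (tχ j)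
        refine (((tψ i).sub h0).eventually_ne (b₂ := 0) ?_).mono fun s hs => sub_ne_zero.1 hs
        rw [zero_mul, sub_zero]
        exact hβ0 i
    have e6 : ∀ᶠ s in 𝓝[≠] (0 : ℂ), ∀ r, s ≠ 0 → ψ r s / s ∈ spectrum ℂ (A + s⁻¹ • B) :=
      eventually_all.2 fun r => (hψs r).filter_mono nhdsWithin_le_nhds
    have e7 : ∀ᶠ s in 𝓝[≠] (0 : ℂ), ∀ r, s ≠ 0 → χ r s ∈ spectrum ℂ (A + s⁻¹ • B) :=
      eventually_all.2 fun r => (hχs r).filter_mono nhdsWithin_le_nhds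
    filter_upwards [hne, e1, e2, e3, e4, e5, e6, e7] with s h0 h1 h2 h3 h4 h5 h6 h7
    refine ⟨fun r => ?_, ?_, fun r => ?_⟩
    · induction r using Fin.addCases with
      | left i =>
        simp only [Fin.addCases_left]
        exact (h1 i).div continuousAt_id h0
      | right j => simpa using h2 j
    · intro r r' hrr
      induction r using Fin.addCases with
      | left i =>
        induction r' using Fin.addCases with
        | left j =>
          simp only [Fin.addCases_left, div_left_inj' h0] at hrr
          rw [h3 hrr]
        | right j =>
          simp only [Fin.addCases_left, Fin.addCases_right, div_eq_iff h0] at hrr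
          exact absurd (hrr.trans (mul_comm _ _)) (h5 i j)
      | right i =>
        induction r' using Fin.addCases with
        | left j =>
          simp only [Fin.addCases_left, Fin.addCases_right, eq_div_iff h0] at hrr
          exact absurd (hrr.symm.trans (mul_comm _ _)) (h5 j i)
        | right j =>
          simp only [Fin.addCases_right] at hrr
          rw [h4 hrr]
    · induction r using Fin.addCases with
      | left i => simpa using h6 i h0
      | right j => simpa using h7 j h0
  · refine (tψ r).congr' ?_
    filter_upwards [hne] with s hs
    rw [Fin.addCases_left, mul_div_cancel₀ _ hs]
  · simpa using tχ r

end Main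

end SectorialPerturbation

theorem theorem4 {H : Type*} [NormedAddCommGroup H] [InnerProductSpace ℂ H]
    [FiniteDimensional ℂ H] (A B : H →ₗ[ℂ] H) (σ₁ σ₂ : ℝ) (M L : ℕ)
    -- `M` is the rank of `B`, and `N = M + L` is the dimension of the space
    (hM : Module.finrank ℂ (LinearMap.range B) = M)
    (hN : Module.finrank ℂ H = M + L)
    (hA : A.IsSymmetric)
    (hB : IsSectorial B σ₁ σ₂)
    (hcyc : IsCyclicFor B A)
    (hA_simple : ∀ μ ∈ spectrum ℂ A, IsSimpleEigenvalue A μ)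
    (hB_simple : ∀ μ ∈ spectrum ℂ B, μ ≠ 0 → IsSimpleEigenvalue B μ)
    (hK_simple : ∀ μ ∈ spectrum ℂ (truncation A (LinearMap.ker B)),
      IsSimpleEigenvalue (truncation A (LinearMap.ker B)) μ)
    -- the eigenvalues of `A` in increasing order
    (α : Fin (M + L) → ℝ) (hα : StrictMono α)
    (hα_spec : spectrum ℂ A = range (fun r => (α r : ℂ)))
    -- the eigenvalues of the truncation of `A` to the kernel of `B` in increasing order
    (δ : Fin L → ℝ) (hδ : StrictMono δ)
    (hδ_spec : spectrum ℂ (truncation A (LinearMap.ker B)) = range (fun r => (δ r : ℂ)))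
    (g : ℝ → ℂ) (hg : IsCouplingCurve A B σ₁ σ₂ g) :
    ∃ lam : Fin (M + L) → ℝ → ℂ,
      (∀ r, IsRegularCurve (lam r)) ∧
      (∀ r, ∀ t : ℝ, 0 ≤ t → g t ≠ 0 → 0 < (lam r t).im) ∧
      (∀ t : ℝ, 0 ≤ t → spectrum ℂ (A + g t • B) = range (fun r => lam r t)) ∧
      (∀ r, lam r 0 = (α r : ℂ)) ∧
      -- the non-zero eigenvalues of `B` in any order
      (∀ β : Fin M → ℂ, Function.Injective β → spectrum ℂ B \ {0} = range β →
        ∃ π : Equiv.Perm (Fin (M + L)),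
          (∀ r : Fin M,
            Tendsto (fun t => lam (π (Fin.castAdd L r)) t / g t) atTop (𝓝 (β r))) ∧
          (∀ r : Fin L,
            Tendsto (fun t => lam (π (Fin.natAdd M r)) t) atTop (𝓝 (δ r : ℂ)))) ∧
      (AnalyticOn ℝ g (Ici 0) → ∀ r, AnalyticOn ℝ (lam r) (Ici 0)) := by
  have hgc : ContinuousOn g (Ici 0) := hg.regular.contDiffOn.continuousOn
  -- Constant extension to negative times, so that the lifting argument can run over the whole line.
  set G : ℝ → ℂ := fun t => g (max t 0) with hG
  have hGc : Continuous G := hgc.comp_continuous (by fun_prop) fun t => mem_Ici.2 (le_max_right t 0)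
  have hGg : ∀ t, 0 ≤ t → G t = g t := fun t ht => by simp only [hG, max_eq_left ht]
  obtain ⟨lam, hlc, hl0, hli, hls⟩ := exists_continuous_listing (N := M + L)
    (fun t => spectrum ℂ (A + G t • B)) (fun t₀ => by
      obtain ⟨φ, hφ⟩ := exists_local_listing (A := A) (B := B) (γ₀ := G t₀) hN
        fun z hz => hg.isSimpleEigenvalue hA_simple (le_max_right t₀ 0) hz
      refine ⟨fun i t => φ i (G t), ?_⟩
      filter_upwards [hGc.continuousAt.eventually hφ] with t ht
      exact ⟨fun i => (ht.1 i).comp (f := G) hGc.continuousAt, ht.2⟩)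
    (fun r => (α r : ℂ)) (Complex.ofReal_injective.comp hα.injective) fun r => by
      rw [hGg 0 le_rfl, hg.map_zero, zero_smul, add_zero, hα_spec]
      exact ⟨r, rfl⟩
  have hspec : ∀ t : ℝ, 0 ≤ t → spectrum ℂ (A + g t • B) = range fun r => lam r t :=
    fun t ht => by rw [← hGg t ht, hls]
  have hmem : ∀ r, ∀ t : ℝ, 0 ≤ t → lam r t ∈ spectrum ℂ (A + g t • B) := fun r t ht => by
    rw [hspec t ht]; exact ⟨r, rfl⟩
  have hA_real : ∀ μ ∈ spectrum ℂ A, ∃ a : ℝ, (a : ℂ) = μ := fun μ hμ => by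
    rw [hα_spec] at hμ
    obtain ⟨r, hr⟩ := hμ
    exact ⟨α r, hr⟩
  -- This local form yields smoothness, the nonvanishing derivative and analyticity alike, through
  -- the chain rule.
  have hloc : ∀ r, ∀ t ∈ Ici (0 : ℝ), ∃ φ : ℂ → ℂ, AnalyticAt ℂ φ (g t) ∧
      deriv φ (g t) ≠ 0 ∧ lam r =ᶠ[𝓝[Ici 0] t] φ ∘ g := fun r t ht =>
    exists_analyticAt_eigenvalue (hgc t ht) ht (hlc r).continuousWithinAt (hmem r)
      (hg.isSimpleEigenvalue hA_simple ht (hmem r t ht))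
      (hg.deriv_detFun_ne_zero hA hB hcyc hA_simple hA_real ht (hmem r t ht))
  refine ⟨lam, fun r => ⟨fun t ht => ?_, fun t ht => ?_⟩, fun r t ht h0 => ?_, hspec, hl0,
    fun β hβ hβ_spec => ?_, fun hga r t ht => ?_⟩
  · obtain ⟨φ, h1, -, h3⟩ := hloc r t ht
    have h4 : ContDiffAt ℝ 1 φ (g t) := h1.contDiffAt.restrict_scalars ℝ
    exact (h4.comp_contDiffWithinAt t (hg.regular.contDiffOn t ht)).congr_of_eventuallyEq h3
      (h3.self_of_nhdsWithin ht)
  · obtain ⟨φ, h1, h2, h3⟩ := hloc r t ht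
    have h4 : HasDerivWithinAt g (derivWithin g (Ici 0) t) (Ici 0) t :=
      ((hg.regular.contDiffOn t ht).differentiableWithinAt (by simp)).hasDerivWithinAt
    have h5 := (h1.differentiableAt.hasDerivAt.comp_hasDerivWithinAt t h4).congr_of_eventuallyEq
      h3 (h3.self_of_nhdsWithin ht)
    rw [h5.derivWithin (uniqueDiffOn_Ici 0 t ht)]
    exact mul_ne_zero h2 (hg.regular.deriv_ne_zero t ht)
  · exact im_pos_of_mem_spectrum hA hB hcyc (hg.mem_couplingSector ht) h0 (hmem r t ht)
  · have hβm : ∀ r, β r ∈ spectrum ℂ B \ {0} := fun r => by rw [hβ_spec]; exact ⟨r, rfl⟩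
    have hδm : ∀ r, (δ r : ℂ) ∈ spectrum ℂ (truncation A (LinearMap.ker B)) := fun r => by
      rw [hδ_spec]; exact ⟨r, rfl⟩
    obtain ⟨h, hh, hhβ, hhδ⟩ := exists_asymptotic_eigenvalues (A := A) hB hβ
      (fun r => (hβm r).1) (fun r => (hβm r).2) (fun r => hB_simple _ (hβm r).1 (hβm r).2)
      (Complex.ofReal_injective.comp hδ.injective) hδm fun r => hK_simple _ (hδm r)
    have hinv : Tendsto (fun t => (g t)⁻¹) atTop (𝓝[≠] 0) :=
      tendsto_inv₀_cobounded'.comp (tendsto_norm_atTop_iff_cobounded.1 hg.tendsto)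
    have hne : ∀ᶠ t in atTop, (g t)⁻¹ ≠ 0 := hinv.eventually self_mem_nhdsWithin
    obtain ⟨T, hT⟩ := eventually_atTop.1
      ((hinv.eventually hh).and (hne.and (eventually_ge_atTop (0 : ℝ))))
    -- Beyond `T` the asymptotic branches evaluated at `1 / g t` and the curves `lam` list the same
    -- spectrum.
    obtain ⟨π, hπ⟩ := exists_perm_of_range_eq (f := lam) (h := fun r t => h r (g t)⁻¹) (T := T)
      (fun r => (hlc r).continuousOn)
      (fun r t ht => by
        obtain ⟨⟨h1, -⟩, h2, h3⟩ := hT t ht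
        have hgt : ContinuousWithinAt g (Ici T) t :=
          (hgc t h3).mono (Ici_subset_Ici.2 (hT T le_rfl).2.2)
        exact (h1 r).comp_continuousWithinAt (f := fun t => (g t)⁻¹)
          (hgt.inv₀ (fun h => h2 (by rw [h, inv_zero]))))
      (fun t _ => hli t) (fun t ht => (hT t ht).1.2.1)
      fun t ht r => by
        obtain ⟨⟨-, -, h1⟩, -, h3⟩ := hT t ht
        have := h1 r
        rwa [inv_inv, hspec t h3] at this
    refine ⟨π, fun r => ?_, fun r => ?_⟩
    · refine ((hhβ r).comp hinv).congr' ?_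
      filter_upwards [eventually_ge_atTop T] with t ht
      rw [← hπ _ t ht, Function.comp_apply, div_eq_inv_mul]
    · refine ((hhδ r).comp hinv).congr' ?_
      filter_upwards [eventually_ge_atTop T] with t ht
      rw [← hπ _ t ht, Function.comp_apply]
  · obtain ⟨φ, h1, -, h3⟩ := hloc r t ht
    exact ((h1.restrictScalars (𝕜 := ℝ)).comp_analyticWithinAt (hga t ht)).congr_of_eventuallyEq
      h3 (h3.self_of_nhdsWithin ht)
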